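/- All graphs are finite and simple. For a graph $G$ with diagonal degree matrix $D_G$ and adjacency matrix $A_G$, its $Q$-spectrum is the multiset of eigenvalues (with multiplicities) of the signless Laplacian matrix $Q_G = D_G + A_G$. A graph $G$ is called DQS (determined by its signless Laplacian spectrum) if every graph with the same $Q$-spectrum as $G$ is isomorphic to $G$. A graph is odd unicyclic if it is connected, has as many edges as vertices, and contains a cycle of odd length. Write $G \sqcup H$ for the disjoint union of $G$ and $H$, $rH$ for the disjoint union of $r$ copies of $H$, and $K_2$ for the complete graph on two vertices. **Theorem.** Let $G$ be an odd unicyclic graph of order $n \ge 7$ that is DQS. Then $G \sqcup rK_2$ is DQS for every positive integer $r$. -/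

import Mathlib

universe u

namespace SimpleGraph

open Classical in
/-- The signless Laplacian matrix `Q_G = D_G + A_G`, with real entries. -/
noncomputable def signlessLapMatrix {V : Type*} [Fintype V] (G : SimpleGraph V) :
    Matrix V V ℝ :=
  G.degMatrix ℝ + G.adjMatrix ℝ

open Classical in
/-- The `Q`-spectrum of `G`: the multiset of eigenvalues of `Q_G`, with multiplicities. (`Q_G` is
real symmetric, so all the roots of its characteristic polynomial are real.) -/
noncomputable def qSpectrum {V : Type*} [Fintype V] (G : SimpleGraph V) : Multiset ℝ :=
  G.signlessLapMatrix.charpoly.roots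

/-- Two finite graphs are `Q`-cospectral if they have the same `Q`-spectrum. -/
def QCospectral {V W : Type*} [Fintype V] [Fintype W]
    (G : SimpleGraph V) (H : SimpleGraph W) : Prop :=
  G.qSpectrum = H.qSpectrum

/-- `G` is determined by its signless Laplacian spectrum: every finite graph `Q`-cospectral with
`G` is isomorphic to `G`. -/
def IsDQS {V : Type u} [Fintype V] (G : SimpleGraph V) : Prop :=
  ∀ (W : Type u) [Fintype W] (H : SimpleGraph W), QCospectral H G → Nonempty (H ≃g G)

/-- A finite graph is unicyclic if it is connected and has as many edges as vertices. -/
def IsUnicyclic {V : Type*} [Fintype V] (G : SimpleGraph V) : Prop :=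
  G.Connected ∧ G.edgeSet.ncard = Fintype.card V

/-- A unicyclic graph is odd unicyclic if it contains a cycle of odd length. -/
def IsOddUnicyclic {V : Type*} [Fintype V] (G : SimpleGraph V) : Prop :=
  G.IsUnicyclic ∧ ∃ (v : V) (p : G.Walk v v), p.IsCycle ∧ Odd p.length

/-- `rG`, the disjoint union of `r` copies of `G`. -/
def copies {V : Type*} (r : ℕ) (G : SimpleGraph V) : SimpleGraph (Fin r × V) where
  Adj p q := p.1 = q.1 ∧ G.Adj p.2 q.2
  symm := ⟨fun _ _ h => ⟨h.1.symm, h.2.symm⟩⟩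
  loopless := ⟨fun _ h => G.loopless.irrefl _ h.2⟩

end SimpleGraph

open Polynomial Matrix Finset

/-! ### Determinants and adjugates of symmetric and incidence-type matrices. -/

namespace Matrix

variable {n : Type*} [Fintype n] [DecidableEq n]

/-! Put φ_G = det(X + Q_G). Cospectrality is equality of these polynomials
(`qCospectral_iff_qPoly_eq`), they multiply over components, and φ of K_2 is X(X + 2). Let H be
cospectral with G ⊔ rK_2. Then H has n + 2r vertices and n + r edges, and X divides φ_H exactly r
times, since φ_G(0) = 4. Each tree component contributes a factor X, so there are at most r trees;
the edge count forces exactly r, with every other component unicyclic, and odd because a bipartite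
component would contribute one more X.

Writing Q = N Nᵀ with N the vertex-edge incidence matrix gives the local data. A tree of order s has
X-coefficient s; an odd unicyclic graph of order s has constant term 4 and X-coefficient congruent
to s times an odd number mod 4. In both cases some principal minor of Q is odd, so (X + 2)² does not
divide φ.

The rest is arithmetic (`card_eq_one_and_forall_eq_two_of_prod_eq`). Let k be the number of
unicyclic components. After the powers of X are cancelled, constant terms show that tree orders are
powers of 2, and the multiplicity of X + 2 gives k ≤ 2. If k = 0 then n ≤ 6; if k = 2 the
X-coefficients disagree mod 4; if k = 1 a one-vertex tree is excluded by parity, so all trees are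
K_2. Cancelling them leaves a component cospectral with G, to which the DQS hypothesis applies. -/

theorem charpoly_neg_coeff_zero {R : Type*} [CommRing R] (A : Matrix n n R) :
    (-A).charpoly.coeff 0 = A.det := by
  rw [coeff_zero_eq_eval_zero, eval_charpoly]
  simp

theorem charpoly_neg_coeff_one {R : Type*} [CommRing R] [Nonempty n] (A : Matrix n n R) :
    (-A).charpoly.coeff 1 = A.adjugate.trace := by
  have h := charpoly_coeff_eq_sum_minors (-A) (Fintype.card n - 1) (Nat.sub_le _ _)
  have hn : 0 < Fintype.card n := Fintype.card_pos
  rw [show Fintype.card n - (Fintype.card n - 1) = 1 by omega] at h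
  rw [h, trace, mul_sum]
  symm
  refine sum_bij (fun v _ => univ.erase v) ?_ ?_ ?_ ?_
  · intro v _
    simp [mem_powersetCard, card_erase_of_mem]
  · intro v _ w _ h
    by_contra hne
    have : w ∈ univ.erase v := by simp [Ne.symm hne]
    rw [h] at this
    simp at this
  · intro s hs
    rw [mem_powersetCard_univ] at hs
    have hc : sᶜ.card = 1 := by rw [card_compl]; omega
    obtain ⟨v, hv⟩ := card_eq_one.1 hc
    refine ⟨v, mem_univ _, ?_⟩
    rw [← compl_singleton, ← hv, compl_compl]
  · intro v _
    rw [submatrix_neg, Pi.neg_apply, Pi.neg_apply, det_neg, Fintype.card_coe,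
      card_erase_of_mem (mem_univ v), card_univ, ← mul_assoc, ← mul_pow]
    simp only [mul_neg, mul_one, neg_neg, one_pow, one_mul]
    rw [← det_piecewise_one_eq_submatrix_det, diag_apply, adjugate_apply]
    congr 1
    ext i j
    by_cases hi : i = v
    · subst hi
      simp [Matrix.one_apply, Pi.single_apply, eq_comm]
    · simp [hi]

/-- By diagonalisability the kernel has dimension at least 2, so it contains a nonzero vector
vanishing at `v`; this vector also kills the matrix whose determinant is the minor at `v`. -/
theorem IsHermitian.adjugate_diag_eq_zero_of_X_sq_dvd_charpoly {A : Matrix n n ℝ}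
    (hA : A.IsHermitian) (h : (X : ℝ[X]) ^ 2 ∣ A.charpoly) (v : n) : A.adjugate v v = 0 := by
  have hne : A.charpoly ≠ 0 := (charpoly_monic A).ne_zero
  have hmul : 2 ≤ A.charpoly.rootMultiplicity 0 := by
    rw [le_rootMultiplicity_iff hne]
    simpa using h
  rw [← count_roots, hA.roots_charpoly_eq_eigenvalues, Multiset.count_map] at hmul
  have hcard : 1 < (univ.filter fun i => (0 : ℝ) = hA.eigenvalues i).card := by
    rw [card_def, filter_val]
    exact hmul
  obtain ⟨i, hi, j, hj, hij⟩ := one_lt_card.1 hcard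
  simp only [mem_filter, mem_univ, true_and] at hi hj
  set b := hA.eigenvectorBasis
  have hbi : A *ᵥ ⇑(b i) = 0 := by rw [hA.mulVec_eigenvectorBasis, ← hi, zero_smul]
  have hbj : A *ᵥ ⇑(b j) = 0 := by rw [hA.mulVec_eigenvectorBasis, ← hj, zero_smul]
  have key : ∃ x : n → ℝ, x ≠ 0 ∧ A *ᵥ x = 0 ∧ x v = 0 := by
    by_cases h0 : b i v = 0
    · refine ⟨⇑(b i), fun hx => b.orthonormal.ne_zero i ?_, hbi, h0⟩
      ext k
      exact congrFun hx k
    · refine ⟨b i v • ⇑(b j) - b j v • ⇑(b i), fun hx => h0 ?_, ?_, ?_⟩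
      · have hx' : b i v • b j - b j v • b i = 0 := by
          ext k
          exact congrFun hx k
        have := congrArg (fun y => inner ℝ (b j) y) hx'
        simpa [inner_sub_right, inner_smul_right, b.inner_eq_ite, Ne.symm hij] using this
      · rw [mulVec_sub, mulVec_smul, mulVec_smul, hbi, hbj]
        simp
      · simp [mul_comm]
  obtain ⟨x, hx0, hAx, hxv⟩ := key
  rw [adjugate_apply, ← exists_mulVec_eq_zero_iff]
  refine ⟨x, hx0, ?_⟩
  ext k
  by_cases hk : k = v
  · subst hk
    simp [mulVec, updateRow_self, hxv]
  · have := congrFun hAx k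
    simpa [mulVec, updateRow_ne hk] using this

/-- A double eigenvalue 2 of `Q` would make the diagonal of the adjugate of `Q - 2` vanish, but `Q -
2` and `Q` agree mod 2, so that entry is odd. -/
theorem not_X_add_two_sq_dvd_of_odd_adjugate {Q : Matrix n n ℤ} (hQ : Qᵀ = Q) {v : n}
    (hv : Odd (Q.adjugate v v)) : ¬ (X + 2 : ℤ[X]) ^ 2 ∣ (-Q).charpoly := by
  rintro ⟨g, hg⟩
  set B : Matrix n n ℤ := Q - scalar n 2 with hB
  have hBcp : (-B).charpoly = X ^ 2 * g.comp (X - 2) := by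
    have h1 := charpoly_sub_scalar (-Q) (-2)
    have h2 : -Q - scalar n (-2 : ℤ) = -B := by rw [hB, map_neg]; abel
    rw [h2, hg] at h1
    rw [h1]
    simp only [mul_comp, pow_comp, add_comp, X_comp, map_neg, ofNat_comp]
    rw [show (C (2 : ℤ)) = 2 from rfl]
    ring_nf
  have hodd : Odd (B.adjugate v v) := by
    rw [← Int.not_even_iff_odd, ← ZMod.intCast_eq_zero_iff_even] at hv ⊢
    have h1 := congrFun (congrFun ((Int.castRingHom (ZMod 2)).map_adjugate Q) v) v
    have h2 := congrFun (congrFun ((Int.castRingHom (ZMod 2)).map_adjugate B) v) v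
    have h3 : (Int.castRingHom (ZMod 2)).mapMatrix B = (Int.castRingHom (ZMod 2)).mapMatrix Q := by
      rw [hB, map_sub]
      have : (Int.castRingHom (ZMod 2)).mapMatrix (scalar n (2 : ℤ)) = 0 := by
        ext i j
        simp only [scalar_apply, RingHom.mapMatrix_apply, map_apply, diagonal_apply, zero_apply]
        split_ifs
        · rfl
        · simp
      rw [this, sub_zero]
    rw [h3] at h2
    simp only [RingHom.mapMatrix_apply, map_apply, eq_intCast] at h1 h2
    rwa [h2, ← h1]
  set A : Matrix n n ℝ := (-B).map (Int.castRingHom ℝ) with hA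
  have hBt : Bᵀ = B := by
    rw [hB, transpose_sub, hQ]
    simp
  have hsym : A.IsHermitian := by
    ext i j
    have : B j i = B i j := congrFun (congrFun hBt i) j
    simp [hA, this]
  have hdvd : (X : ℝ[X]) ^ 2 ∣ A.charpoly := by
    rw [hA, charpoly_map, hBcp]
    simp
  have h0 := hsym.adjugate_diag_eq_zero_of_X_sq_dvd_charpoly hdvd v
  have h1 := congrFun (congrFun ((Int.castRingHom ℝ).map_adjugate (-B)) v) v
  have h2 : (-B).adjugate v v = 0 := by
    simp only [RingHom.mapMatrix_apply] at h1
    rw [← hA, h0] at h1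
    simpa using h1
  have h3 : (-B).adjugate = (-1) ^ (Fintype.card n - 1) • B.adjugate := by
    rw [← adjugate_smul, neg_one_smul]
  rw [h3, smul_apply, smul_eq_mul, mul_eq_zero] at h2
  rcases h2 with h2 | h2
  · exact absurd h2 (pow_ne_zero _ (by norm_num))
  · rw [h2] at hodd
    simp at hodd

theorem isUnit_det_of_forall_exists_mulVec_eq_single {N : Matrix n n ℤ}
    (h : ∀ u, ∃ z, N *ᵥ z = Pi.single u 1) : IsUnit N.det := by
  choose z hz using h
  have : N * (of z)ᵀ = 1 := by
    ext i j
    have := congrFun (hz j) i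
    simpa [mulVec, dotProduct, mul_apply, Pi.single_apply, one_apply] using this
  exact IsUnit.of_mul_eq_one (of z)ᵀ.det (by rw [← det_mul, this, det_one])

/-- The solutions, taken as columns, form a matrix whose product with `N` is the identity with row
`v` replaced by one having 2 on the diagonal; that product has determinant 2. -/
theorem det_dvd_two_of_exists_mulVec {N : Matrix n n ℤ} {v : n}
    (h2 : ∃ z, N *ᵥ z = Pi.single v 2)
    (h : ∀ u, ∃ z, ∃ c : ℤ, N *ᵥ z = Pi.single u 1 + c • Pi.single v 1) : N.det ∣ 2 := by
  obtain ⟨y, hy⟩ := h2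
  choose z c hz using h
  have key : N * (of fun u => if u = v then y else z u)ᵀ =
      (1 : Matrix n n ℤ).updateRow v (fun u => if u = v then 2 else c u) := by
    ext i j
    by_cases hj : j = v
    · subst hj
      have := congrFun hy i
      by_cases hi : i = j
      · subst hi
        simpa [mulVec, dotProduct, mul_apply] using this
      · simpa [mulVec, dotProduct, mul_apply, hi, updateRow_ne, one_apply] using this
    · have := congrFun (hz j) i
      by_cases hi : i = v
      · subst hi
        simpa [mulVec, dotProduct, mul_apply, hj, Ne.symm hj] using this
      · simpa [mulVec, dotProduct, mul_apply, hi, hj, updateRow_ne, one_apply,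
          Pi.single_apply] using this
  refine ⟨(of fun u => if u = v then y else z u)ᵀ.det, ?_⟩
  rw [← det_mul, key, ← det_transpose, ← updateCol_transpose, transpose_one,
    ← cramer_apply, cramer_one]
  simp

theorem even_det_of_sum_col_eq_two [Nonempty n] {N : Matrix n n ℤ} (hcol : ∀ e, ∑ v, N v e = 2) :
    Even N.det := by
  rw [← ZMod.intCast_eq_zero_iff_even]
  have h1 := (Int.castRingHom (ZMod 2)).map_det N
  simp only [eq_intCast] at h1
  rw [h1, ← exists_vecMul_eq_zero_iff]
  refine ⟨1, one_ne_zero, ?_⟩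
  ext e
  have := congrArg (Int.cast : ℤ → ZMod 2) (hcol e)
  push_cast at this
  simp only [vecMul, dotProduct, Pi.one_apply, one_mul, RingHom.mapMatrix_apply, map_apply,
    eq_intCast, Pi.zero_apply]
  rw [this]
  rfl

/-- If `N` is a square integer matrix with all column sums equal to `2`, whose column lattice
contains every `2 δ_v` and, up to multiples of `δ_v`, every `δ_u`, then the adjugate of `N * Nᵀ` is
controlled modulo `4`. -/
theorem det_and_adjugate_mul_transpose [Nonempty n] {N : Matrix n n ℤ}
    (hcol : ∀ e, ∑ v, N v e = 2) (h2 : ∀ v, ∃ z, N *ᵥ z = Pi.single v 2)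
    (h : ∀ v u, ∃ z, ∃ c : ℤ, N *ᵥ z = Pi.single u 1 + c • Pi.single v 1) :
    (N * Nᵀ).det = 4 ∧ (∀ v, Odd ((N * Nᵀ).adjugate v v)) ∧
      ∃ s : ℤ, Odd s ∧ (4 : ℤ) ∣ (N * Nᵀ).adjugate.trace - Fintype.card n * s := by
  obtain ⟨v₀⟩ := ‹Nonempty n›
  have : Nonempty n := ⟨v₀⟩
  have hdet : N.det ^ 2 = 4 := by
    have hd := det_dvd_two_of_exists_mulVec (h2 v₀) (h v₀)
    obtain ⟨k, hk⟩ := even_det_of_sum_col_eq_two hcol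
    obtain ⟨l, hl⟩ := hd
    have hkl : k * l = 1 := by rw [hk] at hl; linarith
    rcases Int.eq_one_or_neg_one_of_mul_eq_one hkl with h | h <;> rw [hk, h] <;> norm_num
  have hQdet : (N * Nᵀ).det = 4 := by rw [det_mul, det_transpose, ← sq, hdet]
  have hdet0 : N.det ≠ 0 := by
    intro h0
    rw [h0] at hdet
    norm_num at hdet
  have hinj : ∀ x y : n → ℤ, N *ᵥ x = N *ᵥ y → x = y := by
    intro x y hxy
    rw [← sub_eq_zero]
    exact eq_zero_of_mulVec_eq_zero hdet0 (by rw [mulVec_sub, hxy, sub_self])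
  have hsum : ∀ x : n → ℤ, ∑ v, (N *ᵥ x) v = 2 * ∑ e, x e := by
    intro x
    simp only [mulVec, dotProduct]
    rw [sum_comm, mul_sum]
    refine sum_congr rfl fun e _ => ?_
    rw [← sum_mul, hcol]
  choose z hz using h2
  -- `Z` is 2N⁻¹, so the adjugate of N Nᵀ, which is 4(N Nᵀ)⁻¹, equals Zᵀ Z, and its diagonal entries
  -- are sums of squares.
  set Z : Matrix n n ℤ := (of z)ᵀ with hZ
  have hNZ : N * Z = (2 : ℤ) • (1 : Matrix n n ℤ) := by
    ext i j
    have := congrFun (hz j) i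
    simpa [hZ, mulVec, dotProduct, mul_apply, Pi.single_apply, one_apply] using this
  have hZN : Z * N = (2 : ℤ) • (1 : Matrix n n ℤ) := by
    have h1 : N.adjugate * (N * (Z * N)) = N.adjugate * ((2 : ℤ) • N) := by
      rw [← Matrix.mul_assoc N, hNZ, Matrix.smul_mul, Matrix.one_mul]
    rw [← Matrix.mul_assoc, Matrix.mul_smul, adjugate_mul, Matrix.smul_mul, Matrix.one_mul,
      smul_comm] at h1
    exact smul_right_injective _ hdet0 h1
  have hadj : (N * Nᵀ).adjugate = Zᵀ * Z := by
    have h1 : (N * Nᵀ) * (Zᵀ * Z) = (4 : ℤ) • (1 : Matrix n n ℤ) := by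
      calc (N * Nᵀ) * (Zᵀ * Z) = N * (Z * N)ᵀ * Z := by
            rw [transpose_mul]; simp only [Matrix.mul_assoc]
        _ = (4 : ℤ) • (1 : Matrix n n ℤ) := by
            rw [hZN, transpose_smul, transpose_one, Matrix.mul_smul, Matrix.mul_one,
              Matrix.smul_mul, hNZ, smul_smul]
            norm_num
    have h2 : (N * Nᵀ).adjugate * ((N * Nᵀ) * (Zᵀ * Z)) = (4 : ℤ) • (N * Nᵀ).adjugate := by
      rw [h1, Matrix.mul_smul, Matrix.mul_one]
    rw [← Matrix.mul_assoc, adjugate_mul, hQdet, Matrix.smul_mul, Matrix.one_mul] at h2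
    exact (smul_right_injective _ (by norm_num : (4 : ℤ) ≠ 0) h2).symm
  have hzsum : ∀ v, ∑ e, z v e = 1 := by
    intro v
    have := hsum (z v)
    rw [hz v] at this
    simp at this
    linarith
  have hdiag : ∀ v, (N * Nᵀ).adjugate v v = ∑ e, z v e ^ 2 := by
    intro v
    rw [hadj]
    simp [hZ, mul_apply, sq]
  have hoddsq : ∀ v, Odd (∑ e, z v e ^ 2) := by
    intro v
    have hev : Even (∑ e, z v e ^ 2 - ∑ e, z v e) := by
      rw [← sum_sub_distrib]
      refine even_sum _ fun e _ => ?_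
      have := Int.even_mul_pred_self (z v e)
      rwa [mul_sub, mul_one, ← sq] at this
    rw [hzsum v] at hev
    obtain ⟨k, hk⟩ := hev
    exact ⟨k, by linarith⟩
  -- All columns of `Z` agree mod 2: 2y = z u + c • z v₀, where c is odd because column sums are 2.
  -- Their squares therefore agree mod 4, which determines the trace mod 4.
  have hcong : ∀ u e, Even (z u e - z v₀ e) := by
    intro u e
    obtain ⟨y, c, hy⟩ := h v₀ u
    have h1 : (2 : ℤ) • y = z u + c • z v₀ := by
      apply hinj
      rw [mulVec_smul, hy, mulVec_add, mulVec_smul, hz, hz]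
      ext i
      simp only [Pi.smul_apply, Pi.add_apply, Pi.single_apply, smul_eq_mul]
      split_ifs <;> ring
    have h2 := hsum y
    rw [hy] at h2
    simp [sum_add_distrib, ← mul_sum] at h2
    have h3 := congrFun h1 e
    simp at h3
    refine ⟨y e - (∑ e, y e) * z v₀ e, ?_⟩
    have hc : c = 2 * ∑ e, y e - 1 := by linarith
    rw [hc] at h3
    linarith
  refine ⟨hQdet, fun v => hdiag v ▸ hoddsq v, ∑ e, z v₀ e ^ 2, hoddsq v₀, ?_⟩
  have : (N * Nᵀ).adjugate.trace - Fintype.card n * ∑ e, z v₀ e ^ 2 =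
      ∑ v, ∑ e, (z v e ^ 2 - z v₀ e ^ 2) := by
    simp [trace, hdiag, sum_sub_distrib]
  rw [this]
  refine dvd_sum fun v _ => dvd_sum fun e _ => ?_
  obtain ⟨k, hk⟩ := hcong v e
  exact ⟨k * (k + z v₀ e), by rw [show z v e = z v₀ e + (k + k) by linarith]; ring⟩

end Matrix

/-! ### Incidence matrices; the polynomial of trees and of odd unicyclic graphs. -/

namespace SimpleGraph

variable {V : Type*} (G : SimpleGraph V)

open Classical in
/-- The signless Laplacian matrix with integer entries. -/
noncomputable def intSignlessLapMatrix [Fintype V] : Matrix V V ℤ :=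
  G.degMatrix ℤ + G.adjMatrix ℤ

open Classical in
/-- The polynomial `det (X + Q_G)`. -/
noncomputable def qPoly [Fintype V] : ℤ[X] :=
  (-G.intSignlessLapMatrix).charpoly

open Classical in
/-- The vertex-edge incidence matrix, with columns indexed by the edges only. -/
noncomputable def edgeIncMatrix : Matrix V G.edgeSet ℤ :=
  Matrix.of fun v e => if v ∈ e.1 then 1 else 0

theorem edgeIncMatrix_apply [DecidableEq V] (v : V) (e : G.edgeSet) :
    G.edgeIncMatrix v e = if v ∈ e.1 then 1 else 0 := by
  simp [edgeIncMatrix]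

theorem qPoly_eq [Fintype V] [DecidableEq V] : G.qPoly = (-G.intSignlessLapMatrix).charpoly := by
  unfold qPoly
  congr!

theorem transpose_intSignlessLapMatrix [Fintype V] :
    G.intSignlessLapMatrixᵀ = G.intSignlessLapMatrix := by
  classical
  rw [intSignlessLapMatrix, transpose_add, G.isSymm_degMatrix ℤ, G.transpose_adjMatrix]

open Classical in
theorem edgeIncMatrix_mul_transpose [Fintype V] :
    G.edgeIncMatrix * G.edgeIncMatrixᵀ = G.intSignlessLapMatrix := by
  have h := G.incMatrix_mul_transpose (R := ℤ)
  have h1 : G.edgeIncMatrix * G.edgeIncMatrixᵀ = G.incMatrix ℤ * (G.incMatrix ℤ)ᵀ := by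
    ext u v
    simp only [mul_apply, transpose_apply]
    rw [← sum_subset (subset_univ G.edgeFinset)]
    · rw [sum_subtype (p := (· ∈ G.edgeSet)) _ (by simp)]
      refine sum_congr rfl ?_
      rintro ⟨e, he⟩ _
      simp [edgeIncMatrix, incMatrix_apply', incidenceSet, he]
    · intro e _ he
      rw [G.incMatrix_of_notMem_incidenceSet, zero_mul]
      intro h
      exact he (by simpa using h.1)
  rw [h1, h]
  ext u v
  simp only [intSignlessLapMatrix, degMatrix, Matrix.of_apply, Matrix.add_apply, diagonal_apply, adjMatrix_apply]
  split_ifs with h1 h2 <;> simp_all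

theorem sum_edgeIncMatrix [Fintype V] (e : G.edgeSet) : ∑ v, G.edgeIncMatrix v e = 2 := by
  classical
  obtain ⟨e, he⟩ := e
  induction e with
  | _ u w =>
    have hne : u ≠ w := G.ne_of_adj he
    simp only [edgeIncMatrix_apply, Sym2.mem_iff]
    rw [sum_boole]
    have : (univ.filter fun x => x = u ∨ x = w) = {u, w} := by ext; simp
    rw [this, card_pair hne]
    rfl

theorem edgeIncMatrix_mulVec_single [Fintype G.edgeSet] [DecidableEq G.edgeSet] [DecidableEq V]
    {u w : V} (h : G.Adj u w) :
    G.edgeIncMatrix *ᵥ Pi.single ⟨s(u, w), h⟩ 1 = Pi.single u 1 + Pi.single w 1 := by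
  ext x
  have hne : u ≠ w := h.ne
  simp only [mulVec_single_one, col_apply, edgeIncMatrix_apply, Sym2.mem_iff, Pi.add_apply,
    Pi.single_apply]
  by_cases h1 : x = u
  · have : x ≠ w := by rintro rfl; exact hne h1.symm
    simp [h1, h1 ▸ this]
  · simp [h1]

/-- The edge columns along the walk, taken with alternating signs, telescope. -/
theorem exists_edgeIncMatrix_mulVec_of_walk [Fintype G.edgeSet] [DecidableEq V] {u w : V}
    (p : G.Walk u w) : ∃ z, G.edgeIncMatrix *ᵥ z =
      (Pi.single u 1 - (-1 : ℤ) ^ p.length • Pi.single w 1 : V → ℤ) := by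
  classical
  induction p with
  | nil => exact ⟨0, by simp⟩
  | cons h p ih =>
    obtain ⟨z, hz⟩ := ih
    refine ⟨Pi.single ⟨s(_, _), h⟩ 1 - z, ?_⟩
    rw [mulVec_sub, edgeIncMatrix_mulVec_single, hz, Walk.length_cons, pow_succ]
    simp only [mul_neg, mul_one, neg_smul]
    abel

theorem trace_intSignlessLapMatrix [Fintype V] :
    G.intSignlessLapMatrix.trace = 2 * G.edgeSet.ncard := by
  classical
  rw [intSignlessLapMatrix, trace_add, G.trace_adjMatrix ℤ, add_zero, degMatrix, trace_diagonal]
  have h := G.sum_degrees_eq_twice_card_edges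
  rw [← Nat.cast_sum, h, Set.ncard_eq_toFinset_card']
  simp [edgeFinset]

theorem qPoly_monic [Fintype V] : G.qPoly.Monic := by
  classical exact charpoly_monic _

theorem natDegree_qPoly [Fintype V] : G.qPoly.natDegree = Fintype.card V := by
  classical exact charpoly_natDegree_eq_dim _

variable {G}

/-- Without odd closed walks there is a 2-colouring, and the corresponding ±1 vector annihilates
every column of the incidence matrix. -/
theorem Connected.exists_odd_walk_of_qPoly_coeff_zero_ne_zero [Fintype V]
    (hc : G.Connected) (h0 : G.qPoly.coeff 0 ≠ 0) : ∃ v, ∃ p : G.Walk v v, Odd p.length := by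
  classical
  by_contra! hcon
  simp only [Nat.not_odd_iff_even] at hcon
  obtain ⟨v⟩ := hc.nonempty
  obtain ⟨c⟩ := two_colorable_iff_forall_loop_even.2 hcon
  rw [qPoly_eq, charpoly_neg_coeff_zero] at h0
  apply h0
  rw [← exists_vecMul_eq_zero_iff]
  refine ⟨fun v => if c v = 0 then 1 else -1, ?_, ?_⟩
  · intro h
    have := congrFun h v
    simp only [Pi.zero_apply] at this
    split_ifs at this
    simp at this
  · rw [← edgeIncMatrix_mul_transpose, ← vecMul_vecMul]
    rw [show (fun v => if c v = 0 then (1 : ℤ) else -1) ᵥ* G.edgeIncMatrix = 0 from ?_, zero_vecMul]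
    ext ⟨e, he⟩
    induction e with
    | _ u w =>
      have h1 := edgeIncMatrix_mulVec_single G he
      have hne : c u ≠ c w := c.valid he
      have h2 : ∀ x : V → ℤ, (x ᵥ* G.edgeIncMatrix) ⟨s(u, w), he⟩ = x u + x w := by
        intro x
        have := dotProduct_mulVec x G.edgeIncMatrix (Pi.single ⟨s(u, w), he⟩ 1)
        rw [h1] at this
        simpa using this.symm
      rw [h2]
      generalize c u = a at *
      generalize c w = b at *
      fin_cases a <;> fin_cases b <;> simp_all

theorem Connected.qPoly_of_odd_walk [Fintype V] (hc : G.Connected)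
    (hcard : G.edgeSet.ncard = Fintype.card V) (hodd : ∃ v, ∃ p : G.Walk v v, Odd p.length) :
    G.qPoly.coeff 0 = 4 ∧ ¬ (X + 2 : ℤ[X]) ^ 2 ∣ G.qPoly ∧
      ∃ s : ℤ, Odd s ∧ (4 : ℤ) ∣ G.qPoly.coeff 1 - Fintype.card V * s := by
  classical
  have : Nonempty V := hc.nonempty
  obtain ⟨e⟩ : Nonempty (V ≃ G.edgeSet) := by
    rw [← Fintype.card_eq, ← hcard, Set.ncard_eq_toFinset_card', Set.toFinset_card]
  set N : Matrix V V ℤ := G.edgeIncMatrix.submatrix id e with hN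
  have hNN : N * Nᵀ = G.intSignlessLapMatrix := by
    rw [hN, transpose_submatrix, submatrix_mul_equiv, edgeIncMatrix_mul_transpose, submatrix_id_id]
  have hmv : ∀ z, N *ᵥ (z ∘ e) = G.edgeIncMatrix *ᵥ z := by
    intro z
    rw [hN, submatrix_mulVec_equiv]
    simp [Function.comp_assoc]
  have hwalk : ∀ {u w} (p : G.Walk u w), ∃ z, N *ᵥ z =
      (Pi.single u 1 - (-1 : ℤ) ^ p.length • Pi.single w 1 : V → ℤ) := by
    intro u w p
    obtain ⟨z, hz⟩ := exists_edgeIncMatrix_mulVec_of_walk G p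
    exact ⟨z ∘ e, by rw [hmv, hz]⟩
  obtain ⟨v₀, p₀, hp₀⟩ := hodd
  have h := det_and_adjugate_mul_transpose (N := N) (fun i => G.sum_edgeIncMatrix (e i)) ?_ ?_
  · rw [hNN] at h
    obtain ⟨h0, h1, h2⟩ := h
    have hpoly := G.qPoly_eq
    rw [hpoly, charpoly_neg_coeff_zero, charpoly_neg_coeff_one]
    exact ⟨h0, not_X_add_two_sq_dvd_of_odd_adjugate G.transpose_intSignlessLapMatrix (h1 v₀), h2⟩
  · intro v
    obtain ⟨p⟩ := hc.preconnected v v₀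
    -- Going to the odd closed walk, around it and back is an odd closed walk at `v`, so the
    -- alternating sum is 2δ_v.
    obtain ⟨z, hz⟩ := hwalk (p.append (p₀.append p.reverse))
    refine ⟨z, ?_⟩
    rw [hz]
    have : Odd (p.append (p₀.append p.reverse)).length := by
      simp only [Walk.length_append, Walk.length_reverse]
      grind
    rw [this.neg_one_pow]
    simp [← Pi.single_add]
  · intro v u
    obtain ⟨p⟩ := hc.preconnected u v
    obtain ⟨z, hz⟩ := hwalk p
    exact ⟨z, -(-1) ^ p.length, by rw [hz, neg_smul, sub_eq_add_neg]⟩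

/-- Appending a column tδ_v makes the incidence matrix square and turns Q into Q + t²E_vv. For t = 0
the determinant vanishes; for t = 1 the matrix is unimodular, by alternating sums along walks to
`v`. Hence every diagonal entry of the adjugate is 1. -/
theorem Connected.qPoly_of_card_edgeSet_add_one [Fintype V] (hc : G.Connected)
    (hcard : G.edgeSet.ncard + 1 = Fintype.card V) :
    G.qPoly.coeff 0 = 0 ∧ G.qPoly.coeff 1 = Fintype.card V ∧ ¬ (X + 2 : ℤ[X]) ^ 2 ∣ G.qPoly := by
  classical
  have : Nonempty V := hc.nonempty
  obtain ⟨e⟩ : Nonempty (V ≃ Option G.edgeSet) := by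
    rw [← Fintype.card_eq, ← hcard, Set.ncard_eq_toFinset_card', Set.toFinset_card,
      Fintype.card_option]
  let B (v : V) (t : ℤ) : Matrix V (Option G.edgeSet) ℤ :=
    Matrix.of fun u o => o.elim (if u = v then t else 0) (G.edgeIncMatrix u)
  have hB : ∀ v t, B v t * (B v t)ᵀ = G.intSignlessLapMatrix +
      Matrix.of fun i j => if i = v then (if j = v then t ^ 2 else 0) else 0 := by
    intro v t
    ext i j
    rw [← edgeIncMatrix_mul_transpose, Matrix.add_apply]
    simp only [mul_apply, Fintype.sum_option, transpose_apply, B, Matrix.of_apply, Option.elim]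
    rw [add_comm]
    congr 1
    split_ifs <;> simp [sq]
  have hdet : ∀ v t, (G.intSignlessLapMatrix +
      Matrix.of fun i j => if i = v then (if j = v then t ^ 2 else 0) else 0).det =
        ((B v t).submatrix id e).det ^ 2 := by
    intro v t
    rw [← hB, sq]
    conv_rhs => arg 2; rw [← det_transpose]
    rw [← det_mul, transpose_submatrix, submatrix_mul_equiv, submatrix_id_id]
  obtain ⟨v₀⟩ := ‹Nonempty V›
  have h0 : G.intSignlessLapMatrix.det = 0 := by
    have h := hdet v₀ 0
    have hz : (Matrix.of fun i j => if i = v₀ then (if j = v₀ then (0 : ℤ) ^ 2 else 0) else 0) =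
        (0 : Matrix V V ℤ) := by
      ext i j
      simp
    rw [hz, add_zero] at h
    rw [h, det_eq_zero_of_column_eq_zero (e.symm none), zero_pow two_ne_zero]
    intro i
    simp [B]
  have h1 : ∀ v, G.intSignlessLapMatrix.adjugate v v = 1 := by
    intro v
    have hu : IsUnit ((B v 1).submatrix id e).det := by
      apply isUnit_det_of_forall_exists_mulVec_eq_single
      intro u
      obtain ⟨p⟩ := hc.preconnected u v
      obtain ⟨z, hz⟩ := exists_edgeIncMatrix_mulVec_of_walk G p
      refine ⟨(fun o : Option G.edgeSet => o.elim ((-1) ^ p.length) z) ∘ e, ?_⟩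
      rw [submatrix_mulVec_equiv]
      ext x
      have hx := congrFun hz x
      simp only [mulVec, dotProduct, Pi.sub_apply, Pi.smul_apply, Pi.single_apply] at hx
      simp only [Function.comp_assoc, Equiv.self_comp_symm, Function.comp_id, Function.comp_apply,
        mulVec, dotProduct, Fintype.sum_option, B, Matrix.of_apply, Option.elim, id]
      rw [hx, Pi.single_apply]
      split_ifs <;> simp
    have h := hdet v 1
    rw [Int.isUnit_iff.1 hu |>.elim (fun h => by rw [h]; rfl) (fun h => by rw [h]; rfl) |>
      fun h : ((B v 1).submatrix id e).det ^ 2 = 1 => h] at h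
    have hupd : (G.intSignlessLapMatrix +
        Matrix.of fun i j => if i = v then (if j = v then (1 : ℤ) ^ 2 else 0) else 0) =
        G.intSignlessLapMatrix.updateRow v (G.intSignlessLapMatrix v + Pi.single v 1) := by
      ext i j
      by_cases hi : i = v
      · subst hi
        simp [Pi.single_apply]
      · simp [hi]
    rwa [hupd, det_updateRow_add, updateRow_eq_self, h0, zero_add, ← adjugate_apply] at h
  rw [qPoly_eq, charpoly_neg_coeff_zero]
  have : Nonempty V := ⟨v₀⟩
  rw [charpoly_neg_coeff_one]
  refine ⟨h0, by simp [trace, h1], ?_⟩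
  refine not_X_add_two_sq_dvd_of_odd_adjugate G.transpose_intSignlessLapMatrix (v := v₀) ?_
  rw [h1]
  exact odd_one

end SimpleGraph

/-! ### Cospectrality, isomorphism and decomposition into components. -/

namespace Matrix

variable {n : Type*} [Fintype n] [DecidableEq n]

theorem charpoly_neg {R : Type*} [CommRing R] (M : Matrix n n R) :
    (-M).charpoly = (-1) ^ Fintype.card n * M.charpoly.comp (-X) := by
  have h : M.charpoly.comp (-X) = (-(charmatrix (-M))).det := by
    have h1 := (compRingHom (-X : R[X])).map_det M.charmatrix
    rw [coe_compRingHom_apply] at h1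
    rw [charpoly, h1]
    congr 1
    ext i j : 1
    by_cases hij : i = j
    · subst hij
      simp [charmatrix_apply_eq]
      ring
    · simp [charmatrix_apply_ne _ _ _ hij]
  rw [h, det_neg, ← mul_assoc, ← mul_pow]
  simp [charpoly]

end Matrix

namespace SimpleGraph

variable {V : Type*} {W : Type*} [Fintype V] [Fintype W]

theorem map_intSignlessLapMatrix (G : SimpleGraph V) :
    G.intSignlessLapMatrix.map (Int.castRingHom ℝ) = G.signlessLapMatrix := by
  classical
  ext i j
  simp [intSignlessLapMatrix, signlessLapMatrix, degMatrix, diagonal_apply, adjMatrix_apply]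

theorem isHermitian_signlessLapMatrix (G : SimpleGraph V) : G.signlessLapMatrix.IsHermitian := by
  rw [← map_intSignlessLapMatrix]
  ext i j
  have : G.intSignlessLapMatrix j i = G.intSignlessLapMatrix i j :=
    congrFun (congrFun G.transpose_intSignlessLapMatrix i) j
  simp [this]

theorem charpoly_signlessLapMatrix [DecidableEq V] (G : SimpleGraph V) :
    G.signlessLapMatrix.charpoly = G.intSignlessLapMatrix.charpoly.map (Int.castRingHom ℝ) := by
  rw [← map_intSignlessLapMatrix, charpoly_map]

/-- The characteristic polynomial of a real symmetric matrix splits, so its roots determine it; the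
passage from Q to -Q is a substitution and a sign fixed by the degree. -/
theorem qCospectral_iff_qPoly_eq {G : SimpleGraph V} {H : SimpleGraph W} :
    QCospectral G H ↔ G.qPoly = H.qPoly := by
  classical
  have hspec : QCospectral G H ↔
      G.signlessLapMatrix.charpoly = H.signlessLapMatrix.charpoly := by
    have hG := G.isHermitian_signlessLapMatrix.splits_charpoly.eq_prod_roots_of_monic
      (charpoly_monic _)
    have hH := H.isHermitian_signlessLapMatrix.splits_charpoly.eq_prod_roots_of_monic
      (charpoly_monic _)
    have e1 : G.qSpectrum = G.signlessLapMatrix.charpoly.roots := by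
      unfold qSpectrum; congr!
    have e2 : H.qSpectrum = H.signlessLapMatrix.charpoly.roots := by
      unfold qSpectrum; congr!
    rw [QCospectral, e1, e2]
    refine ⟨fun h => ?_, fun h => by rw [h]⟩
    rw [hG, hH, h]
  rw [hspec, charpoly_signlessLapMatrix, charpoly_signlessLapMatrix,
    (Polynomial.map_injective _ (RingHom.injective_int (Int.castRingHom ℝ))).eq_iff]
  rw [qPoly_eq, qPoly_eq]
  constructor
  · intro h
    have hd := congrArg natDegree h
    rw [charpoly_natDegree_eq_dim, charpoly_natDegree_eq_dim] at hd
    rw [Matrix.charpoly_neg, Matrix.charpoly_neg, h, hd]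
  · intro h
    have hd := congrArg natDegree h
    rw [charpoly_natDegree_eq_dim, charpoly_natDegree_eq_dim] at hd
    rw [← neg_neg G.intSignlessLapMatrix, ← neg_neg H.intSignlessLapMatrix,
      Matrix.charpoly_neg, Matrix.charpoly_neg (-H.intSignlessLapMatrix), h, hd]

theorem Iso.qPoly_eq {G : SimpleGraph V} {H : SimpleGraph W} (e : G ≃g H) :
    G.qPoly = H.qPoly := by
  classical
  rw [SimpleGraph.qPoly_eq, SimpleGraph.qPoly_eq, ← charpoly_reindex e.toEquiv]
  congr 1
  ext i j
  have hi := e.symm.degree_eq i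
  have hij : G.Adj (e.symm i) (e.symm j) ↔ H.Adj i j := e.symm.map_adj_iff
  simp only [reindex_apply, submatrix_apply, intSignlessLapMatrix, degMatrix, Matrix.neg_apply,
    Matrix.add_apply, diagonal_apply, adjMatrix_apply]
  have h1 : (e.toEquiv.symm i = e.toEquiv.symm j) ↔ i = j := e.toEquiv.symm.injective.eq_iff
  have h2 : e.toEquiv.symm i = e.symm i := rfl
  have h3 : e.toEquiv.symm j = e.symm j := rfl
  simp only [h1]
  rw [h2, h3]
  simp only [hij]
  rw [← hi]

theorem intSignlessLapMatrix_induce {ι : Type*} {G : SimpleGraph V} (f : V → ι)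
    (hf : ∀ u v, G.Adj u v → f u = f v) (i : ι) [Fintype {v | f v = i}] :
    (G.induce {v | f v = i}).intSignlessLapMatrix =
      G.intSignlessLapMatrix.submatrix Subtype.val Subtype.val := by
  classical
  ext ⟨u, hu⟩ ⟨v, hv⟩
  have hdeg : (G.induce {v | f v = i}).degree ⟨u, hu⟩ = G.degree u := by
    convert! degree_induce_of_neighborSet_subset (v := (⟨u, hu⟩ : {v | f v = i}))
      fun w hw => (hf u w hw).symm.trans hu
  simp only [intSignlessLapMatrix, degMatrix, submatrix_apply,
    Matrix.add_apply, diagonal_apply, adjMatrix_apply, Subtype.mk.injEq,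
    comap_adj, Function.Embedding.subtype_apply]
  rw [← hdeg]
  congr!

/-- The polynomial `det (X + Q_G)` is multiplicative over a partition of the vertices into parts
with no edges between them. -/
theorem qPoly_eq_prod_induce {ι : Type*} [Fintype ι] {G : SimpleGraph V} (f : V → ι)
    (hf : ∀ u v, G.Adj u v → f u = f v) [∀ i, Fintype {v | f v = i}] :
    G.qPoly = ∏ i, (G.induce {v | f v = i}).qPoly := by
  classical
  -- The matrix is block diagonal; an arbitrary order on the parts lets it count as block
  -- triangular.
  let o : LinearOrder ι := LinearOrder.lift' (Fintype.equivFin ι) (Fintype.equivFin ι).injective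
  have hbt : (-G.intSignlessLapMatrix).BlockTriangular f := by
    intro u v huv
    have hne : u ≠ v := by rintro rfl; exact lt_irrefl _ huv
    have hadj : ¬ G.Adj u v := fun h => huv.ne (hf u v h).symm
    simp [intSignlessLapMatrix, degMatrix, hne, hadj]
  rw [qPoly_eq, hbt.charpoly]
  rw [prod_subset (subset_univ _)]
  · refine prod_congr rfl fun i _ => ?_
    rw [qPoly_eq]
    have : toSquareBlock (-G.intSignlessLapMatrix) f i =
        -(G.induce {v | f v = i}).intSignlessLapMatrix := by
      rw [intSignlessLapMatrix_induce f hf]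
      rfl
    rw [← this]
    unfold charpoly
    congr!
  · intro i _ hi
    have : IsEmpty {a // f a = i} := ⟨fun a => hi (mem_image.2 ⟨a.1, mem_univ _, a.2⟩)⟩
    exact charpoly_isEmpty

theorem ncard_edgeSet_eq_sum_induce {ι : Type*} [Fintype ι] {G : SimpleGraph V} (f : V → ι)
    (hf : ∀ u v, G.Adj u v → f u = f v) :
    G.edgeSet.ncard = ∑ i, (G.induce {v | f v = i}).edgeSet.ncard := by
  classical
  -- Twice the number of edges is the trace of Q, which splits over the fibres of `f`.
  have h : (2 * G.edgeSet.ncard : ℤ) = ∑ i, 2 * ((G.induce {v | f v = i}).edgeSet.ncard : ℤ) := by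
    simp only [← trace_intSignlessLapMatrix, intSignlessLapMatrix_induce f hf]
    exact (Fintype.sum_fiberwise f G.intSignlessLapMatrix.diag).symm
  rw [← mul_sum] at h
  exact_mod_cast mul_left_cancel₀ two_ne_zero h

end SimpleGraph

/-! ### Factors X + 2 and the arithmetic of component orders. -/

namespace Polynomial

theorem prime_X_add_two : Prime (X + 2 : ℤ[X]) := by
  have := prime_X_sub_C (-2 : ℤ)
  simpa [sub_neg_eq_add] using this

theorem monic_X_add_two : (X + 2 : ℤ[X]).Monic := monic_X_add_C (2 : ℤ)

theorem natDegree_X_add_two : (X + 2 : ℤ[X]).natDegree = 1 := natDegree_X_add_C (2 : ℤ)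

theorem exists_eq_X_add_two_pow_mul {p : ℤ[X]} (hp : p.Monic) :
    ∃ (k : ℕ) (q : ℤ[X]), p = (X + 2) ^ k * q ∧ ¬ (X + 2 : ℤ[X]) ∣ q ∧ q.Monic := by
  obtain ⟨q, hq, hnd⟩ := exists_eq_pow_rootMultiplicity_mul_and_not_dvd p hp.ne_zero (-2)
  have h2 : (X - C (-2) : ℤ[X]) = X + 2 := by simp
  rw [h2] at hq hnd
  refine ⟨_, q, hq, hnd, ?_⟩
  exact (monic_X_add_two.pow _).of_mul_monic_left (hq ▸ hp)

theorem coeff_one_mul (p q : ℤ[X]) :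
    (p * q).coeff 1 = p.coeff 0 * q.coeff 1 + p.coeff 1 * q.coeff 0 := by
  rw [coeff_mul, Nat.sum_antidiagonal_eq_sum_range_succ_mk]
  simp [sum_range_succ]

theorem X_add_two_pow_coeff_zero (k : ℕ) : ((X + 2 : ℤ[X]) ^ k).coeff 0 = 2 ^ k := by
  simp [coeff_zero_eq_eval_zero]

end Polynomial

theorem eq_of_prime_pow_mul_eq {R : Type*} [CommRing R] [IsDomain R] {x a b : R} {k l : ℕ}
    (hx : Prime x) (ha : ¬ x ∣ a) (hb : ¬ x ∣ b) (h : x ^ k * a = x ^ l * b) : k = l ∧ a = b := by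
  induction k generalizing l with
  | zero =>
    cases l with
    | zero => simpa using h
    | succ l => exact absurd ⟨x ^ l * b, by rw [← mul_assoc, ← pow_succ']; simpa using h⟩ ha
  | succ k ih =>
    cases l with
    | zero => exact absurd ⟨x ^ k * a, by rw [← mul_assoc, ← pow_succ']; simpa using h.symm⟩ hb
    | succ l =>
      have := ih (l := l) (mul_left_cancel₀ hx.ne_zero
        (by rw [← mul_assoc, ← mul_assoc, ← pow_succ', ← pow_succ']; exact h))
      exact ⟨by rw [this.1], this.2⟩

theorem Finset.eq_of_sum_le_of_forall_le {ι : Type*} {s : Finset ι} {f g : ι → ℕ}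
    (h : ∀ i ∈ s, f i ≤ g i) (hs : ∑ i ∈ s, g i ≤ ∑ i ∈ s, f i) : ∀ i ∈ s, f i = g i :=
  (sum_eq_sum_iff_of_le h).1 (le_antisymm (sum_le_sum h) hs)

/-- The factor X + 2 makes the X-coefficient of `p` even; as it is `n` times an odd number mod 4,
`n` is even. -/
theorem two_dvd_of_X_add_two_dvd {p q : ℤ[X]} {n : ℕ} (hp : p.coeff 0 = 4)
    (hs : ∃ t : ℤ, Odd t ∧ (4 : ℤ) ∣ p.coeff 1 - n * t) (hq : p = (X + 2) * q) :
    q.coeff 0 = 2 ∧ Even n ∧ p.coeff 1 = 2 + 2 * q.coeff 1 := by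
  have h0 : q.coeff 0 = 2 := by
    rw [hq, mul_coeff_zero] at hp
    simp at hp
    linarith
  have h1 : p.coeff 1 = 2 + 2 * q.coeff 1 := by
    rw [hq, coeff_one_mul, h0]
    simp [coeff_X, coeff_ofNat_zero, coeff_ofNat_succ]
    ring
  refine ⟨h0, ?_, h1⟩
  obtain ⟨t, ht, c, hc⟩ := hs
  rw [h1] at hc
  have : Even ((n : ℤ) * t) := ⟨1 + q.coeff 1 - 2 * c, by linarith⟩
  rw [Int.even_mul] at this
  rcases this with h | h
  · exact_mod_cast h
  · exact absurd h (Int.not_even_iff_odd.2 ht)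

/-- `T` indexes the tree components, with `X * p i = det (X + Q)`, and `U` the odd unicyclic
components, with `p i = det (X + Q)`; `s i` is the order of the component. -/
theorem card_eq_one_and_forall_eq_two_of_prod_eq {ι : Type*} [DecidableEq ι] {T U : Finset ι}
    {p : ι → ℤ[X]} {s : ι → ℕ} {P : ℤ[X]} {n r : ℕ} (hn : 7 ≤ n) (hP : P.Monic)
    (hP0 : P.coeff 0 = 4) (hP1 : ∃ t : ℤ, Odd t ∧ (4 : ℤ) ∣ P.coeff 1 - n * t)
    (hmonic : ∀ i, (p i).Monic)
    (hT0 : ∀ i ∈ T, (p i).coeff 0 = s i) (hTdeg : ∀ i ∈ T, (p i).natDegree + 1 = s i)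
    (hT2 : ∀ i ∈ T, ¬ (X + 2 : ℤ[X]) ^ 2 ∣ p i)
    (hU0 : ∀ i ∈ U, (p i).coeff 0 = 4) (hU2 : ∀ i ∈ U, ¬ (X + 2 : ℤ[X]) ^ 2 ∣ p i)
    (hU1 : ∀ i ∈ U, ∃ t : ℤ, Odd t ∧ (4 : ℤ) ∣ (p i).coeff 1 - s i * t)
    (hprod : (∏ i ∈ T, p i) * ∏ i ∈ U, p i = P * (X + 2) ^ r) (hTcard : T.card = r)
    (hsum : ∑ i ∈ T, s i + ∑ i ∈ U, s i = n + 2 * r) :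
    U.card = 1 ∧ ∀ i ∈ T, s i = 2 := by
  choose ε q hq hqnd hqm using fun i => exists_eq_X_add_two_pow_mul (hmonic i)
  obtain ⟨m, Q, hQ, hQnd, -⟩ := exists_eq_X_add_two_pow_mul hP
  have hle1 : ∀ i, ¬ (X + 2 : ℤ[X]) ^ 2 ∣ p i → ε i ≤ 1 := by
    intro i hi
    by_contra h
    exact hi ((pow_dvd_pow _ (by omega)).trans ⟨q i, hq i⟩)
  have hεT : ∀ i ∈ T, ε i ≤ 1 := fun i hi => hle1 i (hT2 i hi)
  have hεU : ∀ i ∈ U, ε i ≤ 1 := fun i hi => hle1 i (hU2 i hi)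
  obtain ⟨hE, hqprod⟩ : ∑ i ∈ T, ε i + ∑ i ∈ U, ε i = r + m ∧
      (∏ i ∈ T, q i) * ∏ i ∈ U, q i = Q := by
    refine eq_of_prime_pow_mul_eq prime_X_add_two ?_ hQnd ?_
    · rw [prime_X_add_two.dvd_mul, prime_X_add_two.dvd_finsetProd_iff,
        prime_X_add_two.dvd_finsetProd_iff]
      rintro (⟨i, -, h⟩ | ⟨i, -, h⟩) <;> exact hqnd i h
    · have : ∀ S : Finset ι, ∏ i ∈ S, p i = (X + 2) ^ (∑ i ∈ S, ε i) * ∏ i ∈ S, q i := by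
        intro S
        rw [← prod_pow_eq_pow_sum, ← prod_mul_distrib]
        exact prod_congr rfl fun i _ => hq i
      rw [this, this, hQ] at hprod
      rw [pow_add, pow_add]
      linear_combination hprod
  have hconst : (∏ i ∈ T, s i) * 4 ^ U.card = 4 * 2 ^ r := by
    have h := congrArg (fun f => eval 0 f) hprod
    simp only [eval_mul, eval_prod, ← coeff_zero_eq_eval_zero, hP0, X_add_two_pow_coeff_zero] at h
    rw [prod_congr rfl hT0, prod_congr rfl hU0, prod_const] at h
    exact_mod_cast h
  have hpow : ∀ i ∈ T, ∃ a, s i = 2 ^ a := by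
    intro i hi
    have : s i ∣ 2 ^ (2 + r) := by
      rw [pow_add, show 2 ^ 2 = 4 from rfl, ← hconst]
      exact (dvd_prod_of_mem s hi).mul_right _
    obtain ⟨a, -, ha⟩ := (Nat.dvd_prime_pow Nat.prime_two).1 this
    exact ⟨a, ha⟩
  choose! a ha using hpow
  have hA : ∑ i ∈ T, a i + 2 * U.card = r + 2 := by
    rw [prod_congr rfl ha, prod_pow_eq_pow_sum, show 4 = 2 ^ 2 from rfl, ← pow_mul, ← pow_add,
      ← pow_add] at hconst
    have := Nat.pow_right_injective le_rfl hconst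
    omega
  have hqT : ∀ i ∈ T, (2 : ℤ) ^ ε i * (q i).coeff 0 = 2 ^ a i := by
    intro i hi
    have h := hT0 i hi
    rw [ha i hi, hq i, mul_coeff_zero, X_add_two_pow_coeff_zero] at h
    exact_mod_cast h
  have hεa : ∀ i ∈ T, ε i ≤ a i := by
    intro i hi
    have h1 : (2 : ℤ) ^ ε i ∣ 2 ^ a i := ⟨_, (hqT i hi).symm⟩
    have h2 : 2 ^ ε i ∣ 2 ^ a i := by exact_mod_cast h1
    exact (Nat.pow_dvd_pow_iff_le_right one_lt_two).1 h2
  have hsT : ∑ i ∈ T, s i = ∑ i ∈ T, 2 ^ a i := sum_congr rfl ha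
  have hεTsum : ∑ i ∈ T, ε i ≤ ∑ i ∈ T, a i := sum_le_sum hεa
  have hεUsum : ∑ i ∈ U, ε i ≤ U.card := by
    simpa using sum_le_sum hεU
  have hεTsum' : ∑ i ∈ T, ε i ≤ r := by
    simpa [hTcard] using sum_le_sum hεT
  have hUq : ∀ i ∈ U, ε i = 1 →
      (q i).coeff 0 = 2 ∧ Even (s i) ∧ (p i).coeff 1 = 2 + 2 * (q i).coeff 1 := by
    intro i hi h
    refine two_dvd_of_X_add_two_dvd (hU0 i hi) (hU1 i hi) ?_
    have := hq i
    rwa [h, pow_one] at this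
  obtain ⟨t, ht, hPt⟩ := hP1
  -- r ≤ ∑ ε ≤ ∑ a over `T` + |U| = r + 2 - |U|.
  have hk : U.card ≤ 2 := by omega
  have hk012 : U.card = 0 ∨ U.card = 1 ∨ U.card = 2 := by omega
  rcases hk012 with hk | hk | hk
  · exfalso
    have hall : ∀ i ∈ T, ε i = 1 := eq_of_sum_le_of_forall_le hεT (by simp [hTcard]; omega)
    have ha1 : ∀ i ∈ T, 1 ≤ a i := fun i hi => hall i hi ▸ hεa i hi
    have hb : ∑ i ∈ T, (a i - 1) = 2 := by
      have : ∑ i ∈ T, (a i - 1) + ∑ i ∈ T, 1 = ∑ i ∈ T, a i := by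
        rw [← sum_add_distrib]
        exact sum_congr rfl fun i hi => Nat.sub_add_cancel (ha1 i hi)
      simp [hTcard] at this
      omega
    -- A linear bound, with equality at a = 1 and a = 3. Since the excesses a - 1 add up to 2, the
    -- total order is at most 6 + 2r, contradicting n ≥ 7.
    have hbound : ∀ i ∈ T, 2 ^ a i ≤ 3 * (a i - 1) + 2 := by
      intro i hi
      have h1 : a i - 1 ≤ 2 := hb ▸ single_le_sum (f := fun i => a i - 1) (by simp) hi
      have h2 := ha1 i hi
      have : a i = 1 ∨ a i = 2 ∨ a i = 3 := by omega
      rcases this with h | h | h <;> rw [h] <;> norm_num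
    have := sum_le_sum hbound
    rw [sum_add_distrib, ← mul_sum, hb] at this
    simp [hTcard] at this
    rw [card_eq_zero] at hk
    rw [hsT, hk, sum_empty] at hsum
    omega
  · refine ⟨hk, ?_⟩
    obtain ⟨j, rfl⟩ := card_eq_one.1 hk
    rw [sum_singleton] at hE hsum hεUsum
    by_cases hex : ∃ i ∈ T, a i = 0
    swap
    · push Not at hex
      have h1 : ∀ i ∈ T, 1 = a i := eq_of_sum_le_of_forall_le
        (fun i hi => Nat.one_le_iff_ne_zero.2 (hex i hi)) (by simp [hTcard]; omega)
      intro i hi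
      rw [ha i hi, ← h1 i hi]
      rfl
    -- A one-vertex tree has no factor X + 2, so every other component has exactly one and `P` has
    -- none. Then n is odd, while two of the cofactors have even constant term, which makes the
    -- X-coefficient of `P` even.
    exfalso
    obtain ⟨i₀, hi₀, ha₀⟩ := hex
    have hε₀ : ε i₀ = 0 := by have := hεa i₀ hi₀; omega
    have hcard' : (T.erase i₀).card = r - 1 := by rw [card_erase_of_mem hi₀, hTcard]
    have hrpos : 0 < r := hTcard ▸ card_pos.2 ⟨i₀, hi₀⟩
    have hsplitε := add_sum_erase T ε hi₀
    have hsplita := add_sum_erase T a hi₀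
    have hsplit := add_sum_erase T (fun i => 2 ^ a i) hi₀
    simp only [ha₀, hε₀] at hsplitε hsplita hsplit
    have hle' : ∑ i ∈ T.erase i₀, ε i ≤ r - 1 := by
      have := sum_le_sum fun i (hi : i ∈ T.erase i₀) => hεT i (mem_of_mem_erase hi)
      simpa [hcard', hi₀, hTcard] using this
    have hεj := hεU j (mem_singleton_self j)
    have hm : m = 0 := by omega
    have hεj1 : ε j = 1 := by omega
    have hall : ∀ i ∈ T.erase i₀, ε i = 1 :=
      eq_of_sum_le_of_forall_le (fun i hi => hεT i (mem_of_mem_erase hi))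
        (by rw [sum_const, hcard', smul_eq_mul, mul_one]; omega)
    have ha1 : ∀ i ∈ T.erase i₀, 1 ≤ a i :=
      fun i hi => hall i hi ▸ hεa i (mem_of_mem_erase hi)
    obtain ⟨i₁, hi₁, ha₁⟩ : ∃ i ∈ T.erase i₀, 2 ≤ a i := by
      by_contra! hcon
      have := sum_le_sum fun i hi => Nat.le_of_lt_succ (hcon i hi)
      rw [sum_const, hcard', smul_eq_mul, mul_one] at this
      omega
    obtain ⟨hqj, hsj, -⟩ := hUq j (mem_singleton_self j) hεj1
    have hqi₁ : Even ((q i₁).coeff 0) := by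
      have h := hqT i₁ (mem_of_mem_erase hi₁)
      obtain ⟨b, hb⟩ := Nat.exists_eq_add_of_le ha₁
      rw [hall i₁ hi₁, hb, pow_add] at h
      exact ⟨2 ^ b, by linarith⟩
    have hn1 : Odd n := by
      have h1 : Even (∑ i ∈ T.erase i₀, 2 ^ a i) :=
        even_sum _ fun i hi => (even_two).pow_of_ne_zero (by have := ha1 i hi; omega)
      obtain ⟨x, hx⟩ := h1
      obtain ⟨y, hy⟩ := hsj
      rw [hsT] at hsum
      exact ⟨x + y - r, by omega⟩
    have hPeven : Even (P.coeff 1) := by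
      rw [hm, pow_zero, one_mul] at hQ
      rw [hQ, ← hqprod, prod_singleton, ← mul_prod_erase T q (mem_of_mem_erase hi₁),
        coeff_one_mul, mul_coeff_zero, hqj]
      refine Even.add ((hqi₁.mul_right _).mul_right _) (even_two.mul_left _)
    obtain ⟨c, hc⟩ := hPt
    have : Odd (P.coeff 1) := by
      have h1 : Odd ((n : ℤ) * t) := (by exact_mod_cast hn1 : Odd (n : ℤ)).mul ht
      have h2 : P.coeff 1 = n * t + 2 * (2 * c) := by linarith
      rw [h2]
      exact h1.add_even (even_two_mul _)
    exact (Int.not_even_iff_odd.2 this) hPeven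
  · exfalso
    -- All inequalities are now equalities: each tree has order 1 or 2 and cofactor 1, so `P` is the
    -- product of the two unicyclic cofactors and n is the sum of the two even orders minus 2.
    have hm : m = 0 := by omega
    have hεa' : ∀ i ∈ T, ε i = a i := eq_of_sum_le_of_forall_le hεa (by omega)
    have hεU' : ∀ i ∈ U, ε i = 1 := eq_of_sum_le_of_forall_le hεU (by simp; omega)
    have hq1 : ∀ i ∈ T, q i = 1 := by
      intro i hi
      have h1 := hTdeg i hi
      rw [hq i, (monic_X_add_two.pow _).natDegree_mul (hqm i), monic_X_add_two.natDegree_pow,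
        natDegree_X_add_two, mul_one, ha i hi, ← hεa' i hi] at h1
      have h2 := hεT i hi
      have h3 : (q i).natDegree = 0 := by
        have : ε i = 0 ∨ ε i = 1 := by omega
        rcases this with h | h <;> rw [h] at h1 <;> omega
      exact (hqm i).natDegree_eq_zero.1 h3
    have hs1 : ∑ i ∈ T, s i = r + (r - 2) := by
      have : ∀ i ∈ T, s i = 1 + a i := by
        intro i hi
        have h2 := hεT i hi
        have h3 := hεa' i hi
        rw [ha i hi]
        have : a i = 0 ∨ a i = 1 := by omega
        rcases this with h | h <;> rw [h] <;> rfl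
      rw [sum_congr rfl this, sum_add_distrib]
      simp [hTcard]
      omega
    obtain ⟨i, j, hij, rfl⟩ := card_eq_two.1 hk
    rw [sum_pair hij] at hsum
    obtain ⟨hi0, hie, hi1⟩ := hUq i (by simp) (hεU' i (by simp))
    obtain ⟨hj0, hje, hj1⟩ := hUq j (by simp) (hεU' j (by simp))
    obtain ⟨ti, hti, ci, hci⟩ := hU1 i (by simp)
    obtain ⟨tj, htj, cj, hcj⟩ := hU1 j (by simp)
    rw [prod_congr rfl hq1, prod_const_one, one_mul, prod_pair hij] at hqprod
    rw [hm, pow_zero, one_mul, ← hqprod] at hQ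
    have hP1 : P.coeff 1 = 2 * (q i).coeff 1 + 2 * (q j).coeff 1 := by
      rw [hQ, coeff_one_mul, hi0, hj0]
      ring
    obtain ⟨c, hc⟩ := hPt
    obtain ⟨x, hx⟩ := hie
    obtain ⟨y, hy⟩ := hje
    obtain ⟨w, hw⟩ := ht
    obtain ⟨wi, hwi⟩ := hti
    obtain ⟨wj, hwj⟩ := htj
    have hnxy : (n : ℤ) = 2 * x + 2 * y - 2 := by omega
    have hsx : (s i : ℤ) = 2 * x := by omega
    have hsy : (s j : ℤ) = 2 * y := by omega
    rw [hnxy, hw] at hc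
    rw [hsx, hwi, hi1] at hci
    rw [hsy, hwj, hj1] at hcj
    -- Mod 4 the X-coefficient of `P` is both n and the sum of the two orders, which is n + 2;
    -- dividing the difference by 2 leaves an even number equal to 1.
    have key : 2 * (c + (x + y - 1) * w - ci - cj - x * wi - y * wj + 1) = (1 : ℤ) := by
      linarith
    omega

/-! ### The polynomial and the recognition of G ⊔ rK_2. -/

namespace SimpleGraph

theorem nonempty_iso_induce_of_injective {A B : Type*} {K : SimpleGraph A} {L : SimpleGraph B}
    {s : Set B} (φ : A → B) (hφ : Function.Injective φ) (hs : ∀ b, b ∈ s ↔ ∃ a, φ a = b)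
    (hadj : ∀ a a', L.Adj (φ a) (φ a') ↔ K.Adj a a') : Nonempty (K ≃g L.induce s) := by
  refine ⟨⟨Equiv.ofBijective (fun a => ⟨φ a, (hs _).2 ⟨a, rfl⟩⟩) ⟨?_, ?_⟩, ?_⟩⟩
  · intro a a' h
    exact hφ (Subtype.ext_iff.1 h)
  · rintro ⟨b, hb⟩
    obtain ⟨a, rfl⟩ := (hs b).1 hb
    exact ⟨a, rfl⟩
  · intro a a'
    exact hadj a a'

theorem qPoly_completeGraph_fin_two : (completeGraph (Fin 2)).qPoly = X * (X + 2) := by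
  have h : (completeGraph (Fin 2)).intSignlessLapMatrix = !![1, 1; 1, 1] := by
    ext i j
    fin_cases i <;> fin_cases j <;> simp [intSignlessLapMatrix, degMatrix]
    · convert complete_graph_degree (0 : Fin 2)
      simp
    · convert complete_graph_degree (1 : Fin 2)
      simp
  rw [qPoly_eq, h, charpoly_fin_two]
  simp [trace_fin_two, det_fin_two]
  ring

variable {V : Type*} [Fintype V]

theorem qPoly_sum_copies_completeGraph (G : SimpleGraph V) (r : ℕ) :
    (G ⊕g copies r (completeGraph (Fin 2))).qPoly = G.qPoly * (X * (X + 2)) ^ r := by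
  classical
  let f : V ⊕ (Fin r × Fin 2) → Option (Fin r) := Sum.elim (fun _ => none) (fun x => some x.1)
  rw [qPoly_eq_prod_induce f ?_]
  swap
  · rintro (u | u) (v | v) h
    · rfl
    · simp at h
    · simp at h
    · have h' : (copies r (completeGraph (Fin 2))).Adj u v := by simpa using h
      simp [f, h'.1]
  rw [Fintype.prod_option]
  congr 1
  · obtain ⟨e⟩ := nonempty_iso_induce_of_injective (K := G)
      (L := G ⊕g copies r (completeGraph (Fin 2))) (s := {x | f x = none}) Sum.inl
      Sum.inl_injective (by rintro (b | b) <;> simp [f]) (by simp)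
    exact e.qPoly_eq.symm
  · rw [← Fin.prod_const r]
    refine prod_congr rfl fun i _ => ?_
    obtain ⟨e⟩ := nonempty_iso_induce_of_injective (K := completeGraph (Fin 2))
      (L := G ⊕g copies r (completeGraph (Fin 2))) (s := {x | f x = some i})
      (fun j => Sum.inr (i, j)) (fun j j' h => by simpa using h)
      (by rintro (b | ⟨b, c⟩) <;> simp [f, eq_comm]) (by simp [copies])
    rw [← e.qPoly_eq, qPoly_completeGraph_fin_two]

theorem nextCoeff_qPoly (G : SimpleGraph V) : G.qPoly.nextCoeff = 2 * G.edgeSet.ncard := by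
  classical
  have h := trace_eq_neg_charpoly_nextCoeff (-G.intSignlessLapMatrix)
  rw [trace_neg, trace_intSignlessLapMatrix, ← qPoly_eq] at h
  linarith

theorem Connected.adj_of_card_eq_two {G : SimpleGraph V} (hc : G.Connected)
    (h2 : Fintype.card V = 2) {u v : V} (huv : u ≠ v) : G.Adj u v := by
  classical
  have : Nontrivial V := ⟨u, v, huv⟩
  obtain ⟨w, hw⟩ := hc.preconnected.exists_adj_of_nontrivial u
  have h3 : ({u, v} : Finset V) = univ := by
    rw [← card_eq_iff_eq_univ, card_pair huv, h2]
  have : w ∈ ({u, v} : Finset V) := h3 ▸ mem_univ w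
  simp only [mem_insert, mem_singleton] at this
  rcases this with rfl | rfl
  · exact absurd hw (G.loopless.irrefl _)
  · exact hw

/-- A graph with one component isomorphic to `G` and all the others on two vertices. -/
theorem nonempty_iso_sum_copies {W : Type*} [Fintype W] {G : SimpleGraph V} {H : SimpleGraph W}
    {r : ℕ} (hcard : Fintype.card W = Fintype.card V + 2 * r) (c₀ : H.ConnectedComponent)
    (e₀ : H.induce {w | H.connectedComponentMk w = c₀} ≃g G)
    (h2 : ∀ c, c ≠ c₀ → Nat.card {w | H.connectedComponentMk w = c} = 2)
    (hr : Nat.card {c // c ≠ c₀} = r) :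
    Nonempty (H ≃g G ⊕g copies r (completeGraph (Fin 2))) := by
  classical
  have e : Fin r ≃ {c // c ≠ c₀} := 
    (Fintype.equivFinOfCardEq (by rw [← Nat.card_eq_fintype_card, hr])).symm
  have g : ∀ c : {c // c ≠ c₀}, Fin 2 ≃ {w | H.connectedComponentMk w = c.1} := fun c =>
    Fintype.equivOfCardEq (by rw [← Nat.card_eq_fintype_card, ← Nat.card_eq_fintype_card, h2 _ c.2]; simp)
  let Φ : V ⊕ (Fin r × Fin 2) → W :=
    Sum.elim (fun v => (e₀.symm v).1) (fun x => (g (e x.1) x.2).1)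
  have hl : ∀ v, H.connectedComponentMk (Φ (.inl v)) = c₀ := fun v => (e₀.symm v).2
  have hrr : ∀ x, H.connectedComponentMk (Φ (.inr x)) = (e x.1).1 := fun x => (g (e x.1) x.2).2
  have hne : ∀ v x, H.connectedComponentMk (Φ (.inl v)) ≠ H.connectedComponentMk (Φ (.inr x)) :=
    fun v x h => (e x.1).2 (by rw [← hrr, ← h, hl])
  have hsame : ∀ x y, H.connectedComponentMk (Φ (.inr x)) = H.connectedComponentMk (Φ (.inr y)) →
      x.1 = y.1 := fun x y h => e.injective (Subtype.ext (by rw [← hrr, ← hrr, h]))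
  have hinj : Function.Injective Φ := by
    rintro (u | ⟨i, j⟩) (v | ⟨i', j'⟩) h
    · exact congrArg _ (e₀.symm.injective (Subtype.ext h))
    · exact absurd (congrArg _ h) (hne _ _)
    · exact absurd (congrArg _ h).symm (hne _ _)
    · obtain rfl : i = i' := hsame _ _ (congrArg _ h)
      have : j = j' := (g (e i)).injective (Subtype.ext h)
      rw [this]
  have hbij : Function.Bijective Φ := by
    rw [Fintype.bijective_iff_injective_and_card]
    refine ⟨hinj, ?_⟩
    rw [hcard]
    simp [mul_comm]
  have hmk : ∀ {a b}, H.Adj a b → H.connectedComponentMk a = H.connectedComponentMk b :=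
    fun h => ConnectedComponent.sound h.reachable
  have iso : G ⊕g copies r (completeGraph (Fin 2)) ≃g H := by
    refine ⟨Equiv.ofBijective Φ hbij, ?_⟩
    rintro (u | ⟨i, j⟩) (v | ⟨i', j'⟩)
    · rw [sum_adj_inl]
      exact e₀.symm.map_adj_iff
    · exact iff_of_false (fun h => hne _ _ (hmk h)) (by simp)
    · exact iff_of_false (fun h => hne _ _ (hmk h).symm) (by simp)
    · rw [sum_adj_inr]
      constructor
      · intro h
        obtain rfl : i = i' := hsame _ _ (hmk h)
        refine ⟨rfl, ?_⟩
        rintro (rfl : j = j')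
        exact h.ne rfl
      · rintro ⟨hi, hj⟩
        obtain rfl : i = i' := hi
        have hc : (H.induce {w | H.connectedComponentMk w = (e i).1}).Connected :=
          (e i).1.connected_toSimpleGraph
        exact hc.adj_of_card_eq_two (by rw [← Nat.card_eq_fintype_card, h2 _ (e i).2])
          (fun h => hj ((g (e i)).injective h))
  exact ⟨iso.symm⟩

end SimpleGraph

/-! ### Proof of the theorem. -/

namespace SimpleGraph

theorem IsOddUnicyclic.qPoly {V : Type*} [Fintype V] {G : SimpleGraph V} (hG : G.IsOddUnicyclic) :
    G.qPoly.coeff 0 = 4 ∧ ¬ (X + 2 : ℤ[X]) ^ 2 ∣ G.qPoly ∧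
      ∃ s : ℤ, Odd s ∧ (4 : ℤ) ∣ G.qPoly.coeff 1 - Fintype.card V * s := by
  obtain ⟨⟨hc, hcard⟩, v, p, -, hodd⟩ := hG
  exact hc.qPoly_of_odd_walk hcard ⟨v, p, hodd⟩

end SimpleGraph

open SimpleGraph

theorem theorem3p2 {V : Type u} [Fintype V] (G : SimpleGraph V)
    (hn : 7 ≤ Fintype.card V) (hG : G.IsOddUnicyclic) (hDQS : G.IsDQS)
    (r : ℕ) (hr : 0 < r) :
    (G ⊕g SimpleGraph.copies r (SimpleGraph.completeGraph (Fin 2))).IsDQS := by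
  classical
  intro W _ H hcosp
  rw [qCospectral_iff_qPoly_eq, qPoly_sum_copies_completeGraph] at hcosp
  obtain ⟨hG0, -, hG1⟩ := hG.qPoly
  have hmK : (X * (X + 2) : ℤ[X]).Monic := monic_X.mul monic_X_add_two
  have hcardW : Fintype.card W = Fintype.card V + 2 * r := by
    have h := congrArg natDegree hcosp
    rwa [G.qPoly_monic.natDegree_mul (hmK.pow r), hmK.natDegree_pow,
      monic_X.natDegree_mul monic_X_add_two, natDegree_X_add_two, natDegree_X, natDegree_qPoly,
      natDegree_qPoly, mul_comm r] at h
  have hedgeW : H.edgeSet.ncard = Fintype.card V + r := by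
    have h := congrArg nextCoeff hcosp
    rw [G.qPoly_monic.nextCoeff_mul (hmK.pow r), hmK.nextCoeff_pow,
      monic_X.nextCoeff_mul monic_X_add_two, nextCoeff_qPoly, nextCoeff_qPoly, hG.1.2,
      show (X + 2 : ℤ[X]).nextCoeff = 2 from nextCoeff_X_add_C (2 : ℤ),
      show (X : ℤ[X]).nextCoeff = 0 by simpa using nextCoeff_X_add_C (0 : ℤ)] at h
    simp at h
    omega
  let f := H.connectedComponentMk
  have hf : ∀ u v, H.Adj u v → f u = f v := fun u v h => ConnectedComponent.sound h.reachable
  let K (c : H.ConnectedComponent) := H.induce {v | f v = c}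
  let s (c : H.ConnectedComponent) := Fintype.card {v | f v = c}
  let e (c : H.ConnectedComponent) := (K c).edgeSet.ncard
  have hconn : ∀ c, (K c).Connected := fun c => c.connected_toSimpleGraph
  have hprod : H.qPoly = ∏ c, (K c).qPoly := qPoly_eq_prod_induce f hf
  have hssum : ∑ c, s c = Fintype.card W := by
    have h := congrArg natDegree hprod
    rw [natDegree_prod_of_monic _ _ fun c _ => (K c).qPoly_monic, natDegree_qPoly] at h
    rw [h]
    exact sum_congr rfl fun c _ => (natDegree_qPoly _).symm
  have hesum : ∑ c, e c = H.edgeSet.ncard := (ncard_edgeSet_eq_sum_induce f hf).symm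
  have hse : ∀ c, s c ≤ e c + 1 := by
    intro c
    have := (hconn c).card_vert_le_card_edgeSet_add_one
    rwa [Nat.card_eq_fintype_card, Nat.card_coe_set_eq] at this
  let T : Finset H.ConnectedComponent := univ.filter fun c => e c + 1 = s c
  let U : Finset H.ConnectedComponent := univ.filter fun c => ¬ e c + 1 = s c
  have hT : ∀ c ∈ T, e c + 1 = s c := fun c hc => (mem_filter.1 hc).2
  have htree : ∀ c ∈ T, (K c).qPoly.coeff 0 = 0 ∧ (K c).qPoly.coeff 1 = s c ∧
      ¬ (X + 2 : ℤ[X]) ^ 2 ∣ (K c).qPoly :=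
    fun c hc => (hconn c).qPoly_of_card_edgeSet_add_one (hT c hc)
  have hex : ∀ c, ∃ p : ℤ[X], p.Monic ∧ (K c).qPoly = (if c ∈ T then X else 1) * p := by
    intro c
    by_cases hc : c ∈ T
    · obtain ⟨p, hp⟩ := X_dvd_iff.2 (htree c hc).1
      refine ⟨p, ?_, by rw [if_pos hc, hp]⟩
      exact monic_X.of_mul_monic_left (hp ▸ (K c).qPoly_monic)
    · exact ⟨_, (K c).qPoly_monic, by rw [if_neg hc, one_mul]⟩
  choose p hpm hp using hex
  have hpT : ∀ c ∈ T, (K c).qPoly = X * p c := fun c hc => by rw [hp c, if_pos hc]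
  have hpU : ∀ c ∈ U, (K c).qPoly = p c := fun c hc => by
    rw [hp c, if_neg (fun h => (mem_filter.1 hc).2 (hT c h)), one_mul]
  have hsplit : ∀ {M : Type} [AddCommMonoid M] (g : H.ConnectedComponent → M),
      ∑ c, g c = ∑ c ∈ T, g c + ∑ c ∈ U, g c := fun g => (sum_filter_add_sum_filter_not _ _ g).symm
  have hprod' : X ^ T.card * ((∏ c ∈ T, p c) * ∏ c ∈ U, p c) =
      X ^ r * (G.qPoly * (X + 2) ^ r) := by
    rw [hprod, ← prod_filter_mul_prod_filter_not univ fun c => e c + 1 = s c] at hcosp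
    change (∏ c ∈ T, _) * (∏ c ∈ U, _) = _ at hcosp
    rw [prod_congr rfl hpT, prod_congr rfl hpU, prod_mul_distrib, prod_const, mul_pow] at hcosp
    linear_combination hcosp
  have hTle : T.card ≤ r := by
    have hdvd : X ^ T.card ∣ X ^ r * (G.qPoly * (X + 2 : ℤ[X]) ^ r) := ⟨_, hprod'.symm⟩
    by_contra! hlt
    have h1 : (X : ℤ[X]) ∣ G.qPoly * (X + 2) ^ r := by
      have := (pow_dvd_pow X hlt).trans hdvd
      rw [pow_succ] at this
      exact (mul_dvd_mul_iff_left (pow_ne_zero _ X_ne_zero)).1 this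
    rw [X_dvd_iff, mul_coeff_zero, hG0, X_add_two_pow_coeff_zero] at h1
    simp at h1
  have hUle : ∀ c ∈ U, s c ≤ e c := fun c hc => by
    have h1 := hse c
    have h2 : ¬ e c + 1 = s c := (mem_filter.1 hc).2
    omega
  -- Vertices minus edges is r in total. Trees contribute 1 each and the others at most 0, so |T| ≤
  -- r leaves only equality.
  have hcounts : T.card = r ∧ ∑ c ∈ U, e c ≤ ∑ c ∈ U, s c := by
    have h1 := hsplit s
    have h2 := hsplit e
    have h3 : ∑ c ∈ T, s c = ∑ c ∈ T, e c + T.card := by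
      rw [← sum_congr rfl hT, sum_add_distrib]
      simp
    have h4 := sum_le_sum hUle
    omega
  obtain ⟨hTcard, hUsum⟩ := hcounts
  have hU : ∀ c ∈ U, s c = e c := eq_of_sum_le_of_forall_le hUle hUsum
  have hprod'' : (∏ c ∈ T, p c) * ∏ c ∈ U, p c = G.qPoly * (X + 2) ^ r := by
    rw [hTcard] at hprod'
    exact mul_left_cancel₀ (pow_ne_zero _ X_ne_zero) hprod'
  have hUne : ∀ c ∈ U, (K c).qPoly.coeff 0 ≠ 0 := by
    intro c hc h0
    have h := congrArg (fun q => eval 0 q) hprod''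
    simp only [eval_mul, eval_prod, ← coeff_zero_eq_eval_zero, hG0, X_add_two_pow_coeff_zero] at h
    rw [prod_eq_zero hc (by rw [← hpU c hc, h0]), mul_zero] at h
    exact absurd h.symm (by positivity)
  have huni : ∀ c ∈ U, (p c).coeff 0 = 4 ∧ ¬ (X + 2 : ℤ[X]) ^ 2 ∣ p c ∧
      ∃ t : ℤ, Odd t ∧ (4 : ℤ) ∣ (p c).coeff 1 - s c * t := by
    intro c hc
    rw [← hpU c hc]
    exact (hconn c).qPoly_of_odd_walk (hU c hc).symm
      ((hconn c).exists_odd_walk_of_qPoly_coeff_zero_ne_zero (hUne c hc))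
  have hpdeg : ∀ c ∈ T, (p c).natDegree + 1 = s c := by
    intro c hc
    have h := congrArg natDegree (hpT c hc)
    rw [natDegree_X_mul (hpm c).ne_zero, natDegree_qPoly] at h
    exact h.symm
  have hp0 : ∀ c ∈ T, (p c).coeff 0 = s c := by
    intro c hc
    rw [← (htree c hc).2.1, hpT c hc, coeff_X_mul]
  obtain ⟨hU1, hT2⟩ := card_eq_one_and_forall_eq_two_of_prod_eq (p := p) (s := s) hn G.qPoly_monic
    hG0 hG1 hpm hp0 hpdeg
    (fun c hc h => (htree c hc).2.2 (hpT c hc ▸ h.mul_left X))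
    (fun c hc => (huni c hc).1) (fun c hc => (huni c hc).2.1) (fun c hc => (huni c hc).2.2)
    hprod'' hTcard (by rw [← hcardW, ← hssum, hsplit])
  obtain ⟨c₀, hc₀⟩ := card_eq_one.1 hU1
  have hc₀U : c₀ ∈ U := hc₀ ▸ mem_singleton_self c₀
  have hmemT : ∀ c, c ∈ T ↔ c ≠ c₀ := by
    intro c
    rw [Ne, ← mem_singleton (a := c₀), ← hc₀]
    simp [T, U]
  have hlin : ∀ c ∈ T, p c = X + 2 := by
    intro c hc
    have h1 := hpdeg c hc
    have h2 := hp0 c hc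
    rw [hT2 c hc] at h1 h2
    have h3 := (hpm c).eq_X_add_C (by omega)
    rw [h2] at h3
    simpa using h3
  -- The r trees account for all of (X + 2)^r, which cancels.
  have hqK : (K c₀).qPoly = G.qPoly := by
    rw [hc₀, prod_singleton, prod_congr rfl hlin, prod_const, hTcard, mul_comm,
      ← hpU c₀ hc₀U] at hprod''
    exact mul_right_cancel₀ (pow_ne_zero _ monic_X_add_two.ne_zero) hprod''
  obtain ⟨iso⟩ := hDQS _ (K c₀) (qCospectral_iff_qPoly_eq.2 hqK)
  refine nonempty_iso_sum_copies hcardW c₀ iso (fun c hc => ?_) ?_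
  · rw [Nat.card_eq_fintype_card]
    exact hT2 c ((hmemT c).2 hc)
  · rw [← hTcard, Nat.card_congr (Equiv.subtypeEquivRight hmemT).symm]
    simp
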